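/- Let $n\in\mathbb{N}$ and order $\mathbb{R}^n$ coordinatewise. A map $f:\mathbb{R}^n\to\mathbb{R}^n$ is *monotone* if $x\le y$ implies $f(x)\le f(y)$, and (additively) *homogeneous* if $f(c+x)=c+f(x)$ for all $c\in\mathbb{R}$ and $x\in\mathbb{R}^n$, where $c+x=(c+x_1,\dots,c+x_n)$. An *eigenvector* of $f$ is a vector $v\in\mathbb{R}^n$ such that $f(v)=\lambda+v$ for some $\lambda\in\mathbb{R}$. The *recession function* of $f$ is $\widehat f(x)=\lim_{\mu\to+\infty}\mu^{-1}f(\mu x)$; we say that it exists if this limit exists in $\mathbb{R}^n$ for every $x\in\mathbb{R}^n$. An $\mathbb{R}^n$-valued map is *convex* if all its coordinates are convex functions. For a directed graph, a *class* is an equivalence class of nodes for the relation "$i=j$, or there are directed paths from $i$ to $j$ and from $j$ to $i$". A class is *final* if no directed path leads from it to a node outside it. The graph of an $n\times n$ stochastic matrix $P$ has nodes $1,\dots,n$ and an arc $i\to j$ whenever $P_{ij}\neq 0$. The *final graph* of $P$ is the union of the restrictions of this graph to its final classes. For a convex monotone homogeneous map $g:\mathbb{R}^n\to\mathbb{R}^n$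 and $v\in\mathbb{R}^n$, the *subdifferential* is $$\partial g(v)=\{P\in\mathbb{R}^{n\times n} : g(x)-g(v)\ge P(x-v)\ \text{ for all } x\in\mathbb{R}^n\},$$ and all its elements are stochastic matrices. If $g$ has an eigenvector $v$, the *critical graph* of $g$ is the union of the final graphs of the matrices $P\in\partial g(v)$ (it does not depend on the choice of the eigenvector $v$), and the *critical classes* of $g$ are the classes of its critical graph. **Corollary.** Let $f:\mathbb{R}^n\to\mathbb{R}^n$ be monotone and homogeneous. Suppose that its recession function $\widehat f$ exists and is convex (so that $\widehat f$ is a convex monotone homogeneous map with eigenvector $0$), and that $\widehat f$ has exactly one critical class. Then $f$ has an eigenvector. -/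

import Mathlib

open Filter Topology

/-- `f : ℝⁿ → ℝⁿ` is (additively) homogeneous: `f (c + x) = c + f x` for every real `c`, where
`c + x` denotes the vector with entries `c + xᵢ`. -/
def AddHomogeneous {n : ℕ} (f : (Fin n → ℝ) → (Fin n → ℝ)) : Prop :=
  ∀ (c : ℝ) (x : Fin n → ℝ), f (fun i => c + x i) = fun i => c + f x i

/-- `v ∈ ℝⁿ` is an (additive) eigenvector of `f`: `f v = c + v` for some real eigenvalue `c`. -/
def IsAddEigenvector {n : ℕ} (f : (Fin n → ℝ) → (Fin n → ℝ)) (v : Fin n → ℝ) : Prop :=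
  ∃ c : ℝ, f v = fun i => c + v i

/-- `g` is the recession function of `f`: the limit defining it exists at every point `x`, and
`g x = lim_{μ → +∞} μ⁻¹ f (μ x)`. -/
def IsRecessionFunction {n : ℕ} (f g : (Fin n → ℝ) → (Fin n → ℝ)) : Prop :=
  ∀ x : Fin n → ℝ, Tendsto (fun μ : ℝ => μ⁻¹ • f (μ • x)) atTop (𝓝 (g x))

/-- A map into `ℝⁿ` is convex when each of its coordinates is convex. -/
def CoordConvex {n : ℕ} (f : (Fin n → ℝ) → (Fin n → ℝ)) : Prop :=
  ∀ i : Fin n, ConvexOn ℝ Set.univ (fun x => f x i)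

/-- The subdifferential of `f : ℝⁿ → ℝⁿ` at `v`: the matrices `P` such that
`f x - f v ≥ P (x - v)` (entrywise) for all `x`. -/
def vecSubdifferential {n : ℕ} (f : (Fin n → ℝ) → (Fin n → ℝ)) (v : Fin n → ℝ) :
    Set (Matrix (Fin n) (Fin n) ℝ) :=
  {P | ∀ x : Fin n → ℝ, P.mulVec (x - v) ≤ f x - f v}

/-- A directed graph (loops allowed) whose nodes form a subset of `V`. -/
structure NodeDigraph (V : Type*) where
  /-- the set of nodes -/
  nodes : Set V
  /-- the arcs `i → j` -/
  Arc : V → V → Prop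
  left_mem : ∀ {i j : V}, Arc i j → i ∈ nodes
  right_mem : ∀ {i j : V}, Arc i j → j ∈ nodes

/-- `i` has access to `j`: `i = j`, or there is a directed path from `i` to `j`. -/
def NodeDigraph.HasAccess {V : Type*} (G : NodeDigraph V) (i j : V) : Prop :=
  Relation.ReflTransGen G.Arc i j

/-- `C` is a class of `G`: an equivalence class of nodes for mutual access, that is, the set of
nodes of a strongly connected component of `G`. -/
def NodeDigraph.IsClass {V : Type*} (G : NodeDigraph V) (C : Set V) : Prop :=
  ∃ i ∈ G.nodes, C = {j | j ∈ G.nodes ∧ G.HasAccess i j ∧ G.HasAccess j i}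

/-- `C` is a final class of `G`: no node of `C` has access to a node outside `C`. -/
def NodeDigraph.IsFinalClass {V : Type*} (G : NodeDigraph V) (C : Set V) : Prop :=
  G.IsClass C ∧ ∀ i ∈ C, ∀ j : V, G.HasAccess i j → j ∈ C

/-- The graph of a square matrix `P`: all indices are nodes, with an arc `i → j` when
`P i j ≠ 0`. -/
def matrixDigraph {n : ℕ} (P : Matrix (Fin n) (Fin n) ℝ) : NodeDigraph (Fin n) where
  nodes := Set.univ
  Arc i j := P i j ≠ 0
  left_mem _ := Set.mem_univ _
  right_mem _ := Set.mem_univ _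

/-- The final graph of `P`: the union, over the final classes `F` of the graph of `P`, of the
restrictions of that graph to `F`. -/
def finalDigraph {n : ℕ} (P : Matrix (Fin n) (Fin n) ℝ) : NodeDigraph (Fin n) where
  nodes := {i | ∃ F, (matrixDigraph P).IsFinalClass F ∧ i ∈ F}
  Arc i j := ∃ F, (matrixDigraph P).IsFinalClass F ∧ i ∈ F ∧ j ∈ F ∧ (matrixDigraph P).Arc i j
  left_mem := fun ⟨F, hF, hi, _, _⟩ => ⟨F, hF, hi⟩
  right_mem := fun ⟨F, hF, _, hj, _⟩ => ⟨F, hF, hj⟩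

/-- The final graph of a set `S` of matrices: the union of the final graphs of its members. -/
def finalDigraphOfSet {n : ℕ} (S : Set (Matrix (Fin n) (Fin n) ℝ)) : NodeDigraph (Fin n) where
  nodes := {i | ∃ P ∈ S, i ∈ (finalDigraph P).nodes}
  Arc i j := ∃ P ∈ S, (finalDigraph P).Arc i j
  left_mem := fun ⟨P, hP, h⟩ => ⟨P, hP, (finalDigraph P).left_mem h⟩
  right_mem := fun ⟨P, hP, h⟩ => ⟨P, hP, (finalDigraph P).right_mem h⟩

/-- The critical graph of `f`, computed at the eigenvector `v` of `f`: the union of the final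
graphs of the matrices in the subdifferential of `f` at `v`. For a convex monotone homogeneous
map, this graph is the same for all eigenvectors `v`. -/
def criticalDigraphAt {n : ℕ} (f : (Fin n → ℝ) → (Fin n → ℝ)) (v : Fin n → ℝ) :
    NodeDigraph (Fin n) :=
  finalDigraphOfSet (vecSubdifferential f v)

/-- `C` is a critical class of `f`: a class of the critical graph of `f`, computed at some
eigenvector `v` of `f` (for a convex monotone homogeneous map the choice of `v` is irrelevant). -/
def IsCriticalClass {n : ℕ} (f : (Fin n → ℝ) → (Fin n → ℝ)) (C : Set (Fin n)) : Prop :=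
  ∃ v : Fin n → ℝ, IsAddEigenvector f v ∧ (criticalDigraphAt f v).IsClass C

/-! ### Monotone homogeneous maps -/

/-! Two independent facts combine. Vanishing discount: `f` is 1-Lipschitz in the sup norm, so `x ↦ f
(α x)` has a fixed point for each `α < 1`. As `α → 1`, these fixed points, shifted to vanish at one
coordinate, either stay bounded and accumulate at an eigenvector of `f`, or blow up, in which case
their limiting direction is a nonconstant fixed point `z` of the recession function `g`. Rigidity
excludes the second case. By Hahn-Banach some stochastic `P ∈ ∂g(0)` satisfies `P z = g z = z`, so
`z` attains both its minimum and its maximum on the final graph of `P`. Every matrix in `∂g(0)`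
satisfies `Q z ≤ z`, which makes `z` constant on each of its final classes, hence along critical
arcs and on the single critical class. So min and max coincide. -/

theorem AddHomogeneous.lipschitzWith_one {n : ℕ} {f : (Fin n → ℝ) → (Fin n → ℝ)}
    (hom : AddHomogeneous f) (mono : Monotone f) : LipschitzWith 1 f := by
  have key : ∀ x y : Fin n → ℝ, ∀ i, f x i ≤ ‖x - y‖ + f y i := by
    intro x y i
    have h : x ≤ fun j => ‖x - y‖ + y j := by
      intro j
      have h1 := norm_le_pi_norm (x - y) j
      have h2 := le_abs_self ((x - y) j)
      rw [Real.norm_eq_abs] at h1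
      simp only [Pi.sub_apply] at h1 h2 ⊢
      linarith
    have h3 := mono h i
    rwa [hom] at h3
  refine LipschitzWith.of_dist_le_mul fun x y => ?_
  rw [NNReal.coe_one, one_mul, dist_eq_norm, dist_eq_norm, pi_norm_le_iff_of_nonneg (norm_nonneg _)]
  intro i
  have h1 := key x y i
  have h2 := key y x i
  rw [norm_sub_rev y x] at h2
  rw [Pi.sub_apply, Real.norm_eq_abs, abs_le]
  constructor <;> linarith

/-- Banach's fixed point theorem; the bound, from `‖x - f 0‖ ≤ α ‖x‖`, will keep the approximate
eigenvalues bounded as `α → 1`. -/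
theorem LipschitzWith.exists_discounted_fixedPoint {E : Type*} [NormedAddCommGroup E]
    [NormedSpace ℝ E] [CompleteSpace E] {f : E → E} (hf : LipschitzWith 1 f) {α : ℝ}
    (h0 : 0 ≤ α) (h1 : α < 1) : ∃ x, f (α • x) = x ∧ (1 - α) * ‖x‖ ≤ ‖f 0‖ := by
  have hc : ContractingWith ⟨α, h0⟩ (fun x => f (α • x)) := by
    refine ⟨by exact_mod_cast h1, LipschitzWith.of_dist_le_mul fun x y => ?_⟩
    refine (hf.dist_le_mul _ _).trans ?_
    rw [NNReal.coe_one, one_mul, dist_smul₀, Real.norm_of_nonneg h0]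
    rfl
  have hx : f (α • hc.fixedPoint) = hc.fixedPoint := hc.fixedPoint_isFixedPt
  refine ⟨hc.fixedPoint, hx, ?_⟩
  generalize hc.fixedPoint = x at hx
  have h2 := hf.dist_le_mul (α • x) 0
  rw [hx, NNReal.coe_one, one_mul, dist_zero_right, norm_smul, Real.norm_of_nonneg h0,
    dist_eq_norm] at h2
  have h3 := norm_sub_norm_le x (f 0)
  linarith

theorem Ultrafilter.exists_tendsto_of_norm_le {ι E : Type*} [NormedAddCommGroup E] [ProperSpace E]
    (U : Ultrafilter ι) {u : ι → E} {B : ℝ} (h : ∀ᶠ k in (U : Filter ι), ‖u k‖ ≤ B) :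
    ∃ v, Tendsto u U (𝓝 v) := by
  obtain ⟨v, -, hv⟩ := (isCompact_closedBall (0 : E) B).ultrafilter_le_nhds' (U.map u)
    (Ultrafilter.mem_map.2 (h.mono fun k hk => by simpa using hk))
  exact ⟨v, hv⟩

/-- A monotone homogeneous map has an eigenvector when all the fixed points of its recession
function are constant vectors. -/
theorem IsRecessionFunction.exists_isAddEigenvector {n : ℕ} {f g : (Fin n → ℝ) → (Fin n → ℝ)}
    (hrec : IsRecessionFunction f g) (mono : Monotone f) (hom : AddHomogeneous f)
    (hfix : ∀ z, g z = z → ∀ i j, z i = z j) : ∃ v, IsAddEigenvector f v := by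
  rcases Nat.eq_zero_or_pos n with rfl | hn
  · exact ⟨0, 0, Subsingleton.elim _ _⟩
  let o : Fin n := ⟨0, hn⟩
  have hlip := hom.lipschitzWith_one mono
  have hα0 : ∀ k : ℕ, 0 < 1 - 1 / ((k : ℝ) + 2) := by
    intro k
    have : (0 : ℝ) < k + 2 := by positivity
    rw [sub_pos, div_lt_one this]
    linarith [(Nat.cast_nonneg k : (0 : ℝ) ≤ k)]
  have hα1 : ∀ k : ℕ, 1 - 1 / ((k : ℝ) + 2) < 1 := by
    intro k
    have : (0 : ℝ) < 1 / (k + 2) := by positivity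
    linarith
  have hαlim : Tendsto (fun k : ℕ => 1 - 1 / ((k : ℝ) + 2)) atTop (𝓝 1) := by
    have h : Tendsto (fun k : ℕ => (k : ℝ) + 2) atTop atTop :=
      tendsto_atTop_add_const_right _ _ tendsto_natCast_atTop_atTop
    simpa using h.inv_tendsto_atTop.const_sub (1 : ℝ)
  generalize hα : (fun k : ℕ => 1 - 1 / ((k : ℝ) + 2)) = α at hαlim
  replace hα0 : ∀ k, 0 < α k := by rw [← hα]; exact hα0
  replace hα1 : ∀ k, α k < 1 := by rw [← hα]; exact hα1
  choose x hx hxb using fun k => hlip.exists_discounted_fixedPoint (hα0 k).le (hα1 k)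
  -- Along an ultrafilter bounded sequences converge without extracting subsequences, and a norm not
  -- eventually bounded tends to infinity.
  let U : Ultrafilter ℕ := hyperfilter ℕ
  have hU : (U : Filter ℕ) ≤ atTop := Nat.hyperfilter_le_atTop
  replace hαlim : Tendsto α U (𝓝 1) := hαlim.mono_left hU
  let w : ℕ → Fin n → ℝ := fun k i => x k i - x k o
  let c : ℕ → ℝ := fun k => (1 - α k) * x k o
  have hc : ∀ k, ‖c k‖ ≤ ‖f 0‖ := by
    intro k
    have h1 : 0 ≤ 1 - α k := by linarith [hα1 k]
    rw [norm_mul, Real.norm_of_nonneg h1]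
    exact (mul_le_mul_of_nonneg_left (norm_le_pi_norm (x k) o) h1).trans (hxb k)
  -- Homogeneity turns the discounted equation into an approximate eigenvector equation with bounded
  -- eigenvalue `c k`.
  have hw : ∀ k, f (α k • w k) = fun i => c k + w k i := by
    intro k
    have h1 : α k • x k = fun i => α k * x k o + (α k • w k) i := by
      funext i; simp [w]; ring
    have h2 := hx k
    rw [h1, hom] at h2
    funext i
    have h3 := congrFun h2 i
    simp only [w, c] at h3 ⊢
    linarith
  obtain ⟨lam, hlam⟩ := U.exists_tendsto_of_norm_le (Eventually.of_forall hc)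
  by_cases hb : ∃ B, ∀ᶠ k in (U : Filter ℕ), ‖w k‖ ≤ B
  · obtain ⟨B, hB⟩ := hb
    obtain ⟨v, hv⟩ := U.exists_tendsto_of_norm_le hB
    refine ⟨v, lam, ?_⟩
    have h1 : Tendsto (fun k => f (α k • w k)) U (𝓝 (f v)) := by
      have h2 := hαlim.smul hv
      rw [one_smul] at h2
      exact (hlip.continuous.tendsto v).comp h2
    refine tendsto_nhds_unique h1 ?_
    simp only [hw]
    rw [tendsto_pi_nhds] at hv ⊢
    exact fun i => hlam.add (hv i)
  exfalso
  have hs : Tendsto (fun k => ‖w k‖) U atTop := by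
    refine tendsto_atTop.2 fun B => ?_
    have h1 : ¬ ∀ᶠ k in (U : Filter ℕ), ‖w k‖ ≤ B := fun h => hb ⟨B, h⟩
    filter_upwards [Ultrafilter.eventually_not.2 h1] with k hk
    exact (not_le.1 hk).le
  have hspos : ∀ᶠ k in (U : Filter ℕ), 0 < ‖w k‖ := hs.eventually_gt_atTop 0
  have hznorm : ∀ᶠ k in (U : Filter ℕ), ‖‖w k‖⁻¹ • w k‖ = 1 := by
    filter_upwards [hspos] with k hk
    rw [norm_smul, norm_inv, norm_norm, inv_mul_cancel₀ hk.ne']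
  obtain ⟨z, hz⟩ := U.exists_tendsto_of_norm_le (hznorm.mono fun k hk => hk.le)
  have hz1 : ‖z‖ = 1 :=
    tendsto_nhds_unique (hz.norm) (tendsto_const_nhds.congr' (hznorm.mono fun k hk => hk.symm))
  have hzo : z o = 0 := by
    refine tendsto_nhds_unique ((tendsto_pi_nhds.1 hz) o) ?_
    simp [w]
  have hμ : Tendsto (fun k => α k * ‖w k‖) U atTop := hαlim.pos_mul_atTop one_pos hs
  have hlim1 := (hrec z).comp hμ
  have hlim2 : Tendsto (fun k => (α k * ‖w k‖)⁻¹ • f (α k • w k)) U (𝓝 z) := by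
    rw [tendsto_pi_nhds]
    intro i
    have h1 : Tendsto (fun k => (α k * ‖w k‖)⁻¹ * c k + (α k)⁻¹ * (‖w k‖⁻¹ • w k) i) U
        (𝓝 (0 * lam + 1⁻¹ * z i)) :=
      (hμ.inv_tendsto_atTop.mul hlam).add
        ((hαlim.inv₀ one_ne_zero).mul ((tendsto_pi_nhds.1 hz) i))
    rw [zero_mul, zero_add, inv_one, one_mul] at h1
    refine h1.congr fun k => ?_
    rw [hw]
    simp only [Pi.smul_apply, smul_eq_mul, mul_inv]
    ring
  -- The recession limit is taken along a fixed direction; nonexpansiveness allows the moving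
  -- direction `w k / ‖w k‖` to be replaced by its limit `z`.
  have hlim3 : Tendsto (fun k => (α k * ‖w k‖)⁻¹ • f (α k • w k)
      - (α k * ‖w k‖)⁻¹ • f ((α k * ‖w k‖) • z)) U (𝓝 0) := by
    have h0 : Tendsto (fun k => ‖‖w k‖⁻¹ • w k - z‖) U (𝓝 0) := by
      simpa using (hz.sub_const z).norm
    refine squeeze_zero_norm' ?_ h0
    filter_upwards [hspos] with k hk
    have hm : 0 < α k * ‖w k‖ := mul_pos (hα0 k) hk
    have h1 := hlip.dist_le_mul (α k • w k) ((α k * ‖w k‖) • z)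
    have h2 : α k • w k = (α k * ‖w k‖) • (‖w k‖⁻¹ • w k) := by
      rw [smul_smul, mul_assoc, mul_inv_cancel₀ hk.ne', mul_one]
    rw [NNReal.coe_one, one_mul, dist_eq_norm, dist_eq_norm] at h1
    rw [← smul_sub, norm_smul, norm_inv, Real.norm_of_nonneg hm.le]
    rw [inv_mul_le_iff₀ hm]
    refine h1.trans (le_of_eq ?_)
    rw [h2, ← smul_sub, norm_smul, Real.norm_of_nonneg hm.le]
  have hgz : g z = z := by
    have h := hlim2.sub hlim3
    simp only [sub_sub_cancel, sub_zero] at h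
    exact tendsto_nhds_unique hlim1 h
  have hz0 : z = 0 := by
    funext i
    rw [hfix z hgz i o, hzo]
    rfl
  rw [hz0, norm_zero] at hz1
  exact zero_ne_one hz1

/-! ### Properties of recession functions -/

namespace IsRecessionFunction

variable {n : ℕ} {f g : (Fin n → ℝ) → (Fin n → ℝ)}

theorem map_zero (h : IsRecessionFunction f g) : g 0 = 0 := by
  refine tendsto_nhds_unique (h 0) ?_
  simp only [smul_zero]
  simpa using (tendsto_inv_atTop_zero (𝕜 := ℝ)).smul_const (f 0)

theorem map_smul (h : IsRecessionFunction f g) {r : ℝ} (hr : 0 < r) (x : Fin n → ℝ) :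
    g (r • x) = r • g x := by
  refine tendsto_nhds_unique (h (r • x)) ?_
  have h1 : Tendsto (fun μ : ℝ => μ * r) atTop atTop := tendsto_id.atTop_mul_const hr
  refine (((h x).comp h1).const_smul r).congr fun μ => ?_
  simp only [Function.comp_apply, smul_smul, mul_inv]
  congr 1
  field_simp

theorem monotone (h : IsRecessionFunction f g) (mono : Monotone f) : Monotone g := by
  intro x y hxy
  refine le_of_tendsto_of_tendsto (h x) (h y) ?_
  filter_upwards [eventually_gt_atTop 0] with μ hμ
  exact smul_le_smul_of_nonneg_left (mono (smul_le_smul_of_nonneg_left hxy hμ.le))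
    (inv_nonneg.2 hμ.le)

theorem addHomogeneous (h : IsRecessionFunction f g) (hom : AddHomogeneous f) :
    AddHomogeneous g := by
  intro c x
  refine tendsto_nhds_unique (h _) ?_
  have h1 := h x
  rw [tendsto_pi_nhds] at h1 ⊢
  intro i
  refine ((h1 i).const_add c).congr' ?_
  filter_upwards [eventually_gt_atTop 0] with μ hμ
  have h2 : (μ • fun j => c + x j) = fun j => μ * c + (μ • x) j := by
    funext j; simp [mul_add]
  rw [h2, hom]
  simp only [Pi.smul_apply, smul_eq_mul, mul_add]
  rw [inv_mul_cancel_left₀ hμ.ne']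

theorem map_add_le (h : IsRecessionFunction f g) (hconv : CoordConvex g) (x y : Fin n → ℝ) :
    g (x + y) ≤ g x + g y := by
  intro i
  have h1 := (hconv i).2 (Set.mem_univ x) (Set.mem_univ y)
    (show (0 : ℝ) ≤ 1 / 2 by norm_num) (show (0 : ℝ) ≤ 1 / 2 by norm_num) (by norm_num)
  rw [← smul_add] at h1
  simp only [h.map_smul (show (0 : ℝ) < 1 / 2 by norm_num), Pi.smul_apply, smul_eq_mul] at h1
  simp only [Pi.add_apply]
  linarith

/-- A convex recession function is attained at each point by an element of its subdifferential
at the origin. -/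
theorem exists_mem_vecSubdifferential (h : IsRecessionFunction f g) (hconv : CoordConvex g)
    (z : Fin n → ℝ) : ∃ P ∈ vecSubdifferential g 0, P.mulVec z = g z := by
  have key : ∀ i, ∃ φ : (Fin n → ℝ) →ₗ[ℝ] ℝ, (∀ x, φ x ≤ g x i) ∧ φ z = g z i := by
    intro i
    have hneg : - g (-z) i ≤ g z i := by
      have := h.map_add_le hconv z (-z) i
      rw [add_neg_cancel, h.map_zero] at this
      simp only [Pi.zero_apply, Pi.add_apply] at this
      linarith
    by_cases hz : z = 0
    · obtain ⟨φ, -, hφ⟩ := exists_extension_of_le_sublinear (E := Fin n → ℝ) ⟨⊥, 0⟩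
        (fun x => g x i) (fun c hc x => by rw [h.map_smul hc]; rfl)
        (fun x y => h.map_add_le hconv x y i) (by
          rintro ⟨x, hx⟩
          obtain rfl : x = 0 := by simpa using hx
          simp [h.map_zero])
      exact ⟨φ, hφ, by simp [hz, h.map_zero]⟩
    -- Hahn-Banach from the line through `z`: the functional `t z ↦ t (g z)ᵢ` is dominated by `gᵢ`,
    -- using `hneg` when `t < 0`.
    · obtain ⟨φ, hφz, hφ⟩ := exists_extension_of_le_sublinear (E := Fin n → ℝ)
        (LinearPMap.mkSpanSingleton z (g z i) hz)
        (fun x => g x i) (fun c hc x => by rw [h.map_smul hc]; rfl)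
        (fun x y => h.map_add_le hconv x y i) (by
          rintro ⟨x, hx⟩
          obtain ⟨t, rfl⟩ := Submodule.mem_span_singleton.1 hx
          rw [LinearPMap.mkSpanSingleton'_apply]
          simp only [smul_eq_mul]
          rcases lt_trichotomy t 0 with ht | rfl | ht
          · have h1 : t • z = (-t) • (-z) := by simp
            rw [h1, h.map_smul (neg_pos.2 ht)]
            simp only [Pi.smul_apply, smul_eq_mul]
            rw [RingHom.id_apply]
            nlinarith
          · simp [h.map_zero]
          · rw [h.map_smul ht]; rfl)
      refine ⟨φ, hφ, ?_⟩
      have h1 := hφz ⟨z, Submodule.mem_span_singleton_self z⟩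
      have h2 := LinearPMap.mkSpanSingleton_apply (σ := RingHom.id ℝ) ℝ ℝ hz (g z i)
      exact h1.trans h2
  choose φ hφ hφz using key
  have hmul : ∀ x, (Matrix.of fun i j => φ i (Pi.single j 1)).mulVec x = fun i => φ i x := by
    intro x
    funext i
    rw [LinearMap.pi_apply_eq_sum_univ (φ i) x]
    simp only [Matrix.mulVec, dotProduct, Matrix.of_apply, smul_eq_mul]
    refine Finset.sum_congr rfl fun j _ => ?_
    rw [mul_comm]
    congr 2
    funext k
    simp [Pi.single_apply, eq_comm]
  refine ⟨Matrix.of fun i j => φ i (Pi.single j 1), fun x => ?_, ?_⟩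
  · rw [hmul, sub_zero, h.map_zero, sub_zero]
    exact fun i => hφ i x
  · rw [hmul]
    exact funext hφz

end IsRecessionFunction

/-! ### Stochastic matrices -/

/-- Lowering coordinate `j` by one cannot raise `g`, so the subgradient inequality gives `-P i j ≤
0`. -/
theorem nonneg_of_mem_vecSubdifferential {n : ℕ} {g : (Fin n → ℝ) → (Fin n → ℝ)}
    {v : Fin n → ℝ} {P : Matrix (Fin n) (Fin n) ℝ} (hP : P ∈ vecSubdifferential g v)
    (mono : Monotone g) (i j : Fin n) : 0 ≤ P i j := by
  have h1 := hP (v - Pi.single j 1) i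
  have h2 : g (v - Pi.single j 1) i ≤ g v i := mono (sub_le_self _ (Pi.single_nonneg.2 zero_le_one)) i
  rw [sub_sub_cancel_left, Matrix.mulVec_neg, Matrix.mulVec_single_one] at h1
  simp only [Pi.neg_apply, Pi.sub_apply, Matrix.col_apply] at h1
  linarith

theorem sum_row_of_mem_vecSubdifferential {n : ℕ} {g : (Fin n → ℝ) → (Fin n → ℝ)}
    {v : Fin n → ℝ} {P : Matrix (Fin n) (Fin n) ℝ} (hP : P ∈ vecSubdifferential g v)
    (hom : AddHomogeneous g) (i : Fin n) : ∑ j, P i j = 1 := by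
  have key : ∀ c : ℝ, (∑ j, P i j) * c ≤ c := by
    intro c
    have h1 := hP (fun i => c + v i) i
    rw [hom] at h1
    simpa [Matrix.mulVec, dotProduct, Finset.sum_mul] using h1
  linarith [key 1, key (-1)]

/-- Minimum principle along one arc. -/
theorem eq_of_sum_mul_le_of_forall_le {ι : Type*} [Fintype ι] {p z : ι → ℝ} {m : ℝ}
    (hp : ∀ j, 0 ≤ p j) (hsum : ∑ j, p j = 1) (hle : ∑ j, p j * z j ≤ m)
    (hm : ∀ j, p j ≠ 0 → m ≤ z j) {j : ι} (hj : p j ≠ 0) : z j = m := by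
  have hnn : ∀ k ∈ Finset.univ, 0 ≤ p k * (z k - m) := by
    intro k _
    by_cases hk : p k = 0
    · simp [hk]
    · exact mul_nonneg (hp k) (sub_nonneg.2 (hm k hk))
  have h0 : ∑ k, p k * (z k - m) = 0 := by
    refine le_antisymm ?_ (Finset.sum_nonneg hnn)
    simp only [mul_sub, Finset.sum_sub_distrib, ← Finset.sum_mul, hsum]
    linarith
  have h1 := (Finset.sum_eq_zero_iff_of_nonneg hnn).1 h0 j (Finset.mem_univ j)
  linarith [(mul_eq_zero.1 h1).resolve_left hj]

theorem NodeDigraph.HasAccess.mem_of_closed {V : Type*} {G : NodeDigraph V} {S : Set V}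
    (hS : ∀ i ∈ S, ∀ j, G.Arc i j → j ∈ S) {i j : V} (h : G.HasAccess i j) (hi : i ∈ S) :
    j ∈ S := by
  induction h with
  | refl => exact hi
  | tail _ hbc ih => exact hS _ ih _ hbc

/-- A nonempty set of nodes which is closed under the arcs of a finite digraph meets a final
class. -/
theorem NodeDigraph.exists_isFinalClass_of_closed {V : Type*} [Finite V] {G : NodeDigraph V}
    {S : Set V} (hne : S.Nonempty) (hS : ∀ i ∈ S, ∀ j, G.Arc i j → j ∈ S) (hG : S ⊆ G.nodes) :
    ∃ i ∈ S, ∃ F, G.IsFinalClass F ∧ i ∈ F := by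
  -- Choose a node reaching the fewest nodes: whatever it reaches has the same reachable set, hence
  -- reaches it back.
  obtain ⟨i, hi, hmin⟩ := Set.exists_min_image S (fun i => {j | G.HasAccess i j}.ncard)
    S.toFinite hne
  have hback : ∀ j, G.HasAccess i j → G.HasAccess j i := by
    intro j hj
    have hsub : {k | G.HasAccess j k} ⊆ {k | G.HasAccess i k} := fun k hk =>
      Relation.ReflTransGen.trans hj hk
    have heq := Set.eq_of_subset_of_ncard_le hsub (hmin j (hj.mem_of_closed hS hi))
    have : i ∈ {k | G.HasAccess i k} := Relation.ReflTransGen.refl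
    rw [← heq] at this
    exact this
  refine ⟨i, hi, _, ⟨⟨i, hG hi, rfl⟩, ?_⟩, hG hi, .refl, .refl⟩
  rintro j ⟨-, hij, -⟩ k hjk
  have hik : G.HasAccess i k := Relation.ReflTransGen.trans hij hjk
  exact ⟨hG (hik.mem_of_closed hS hi), hik, hback k hik⟩

/-- A superharmonic vector of a stochastic matrix is constant on each final class. -/
theorem eq_of_mem_isFinalClass {n : ℕ} {P : Matrix (Fin n) (Fin n) ℝ} {z : Fin n → ℝ}
    (hP : ∀ i j, 0 ≤ P i j) (hsum : ∀ i, ∑ j, P i j = 1) (hz : P.mulVec z ≤ z)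
    {F : Set (Fin n)} (hF : (matrixDigraph P).IsFinalClass F) {i j : Fin n} (hi : i ∈ F)
    (hj : j ∈ F) : z i = z j := by
  obtain ⟨m, hmF, hmin⟩ := Set.exists_min_image F z F.toFinite ⟨i, hi⟩
  have hclosed : ∀ a ∈ {a | a ∈ F ∧ z a = z m}, ∀ b, (matrixDigraph P).Arc a b →
      b ∈ {a | a ∈ F ∧ z a = z m} := by
    rintro a ⟨haF, ha⟩ b hab
    have hout : ∀ k, P a k ≠ 0 → k ∈ F := fun k hk =>
      hF.2 a haF k (Relation.ReflTransGen.single hk)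
    exact ⟨hout b hab, eq_of_sum_mul_le_of_forall_le (hP a) (hsum a) (ha ▸ hz a)
      (fun k hk => hmin k (hout k hk)) hab⟩
  have hall : ∀ a ∈ F, z a = z m := by
    intro a ha
    obtain ⟨r, -, rfl⟩ := hF.1
    have hma : (matrixDigraph P).HasAccess m a := Relation.ReflTransGen.trans hmF.2.2 ha.2.1
    exact (hma.mem_of_closed hclosed ⟨hmF, rfl⟩).2
  rw [hall i hi, hall j hj]

/-- The minimum of a superharmonic vector of a stochastic matrix is attained at a node of the
final graph. -/
theorem exists_mem_finalDigraph_forall_le {n : ℕ} [NeZero n] {P : Matrix (Fin n) (Fin n) ℝ}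
    {z : Fin n → ℝ} (hP : ∀ i j, 0 ≤ P i j) (hsum : ∀ i, ∑ j, P i j = 1)
    (hz : P.mulVec z ≤ z) : ∃ i ∈ (finalDigraph P).nodes, ∀ j, z i ≤ z j := by
  obtain ⟨m, hm⟩ := Finite.exists_min z
  obtain ⟨i, hi, F, hF, hiF⟩ := NodeDigraph.exists_isFinalClass_of_closed
    (G := matrixDigraph P) (S := {a | z a = z m}) ⟨m, rfl⟩
    (fun a ha b hab => eq_of_sum_mul_le_of_forall_le (hP a) (hsum a)
      ((hz a).trans_eq ha) (fun k _ => hm k) hab) (Set.subset_univ _)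
  exact ⟨i, ⟨F, hF, hiF⟩, fun j => (Set.mem_ofPred.1 hi).le.trans (hm j)⟩

/-- If a convex recession function has at most one critical class, its fixed points are
constant vectors. -/
theorem IsRecessionFunction.eq_of_fixedPoint {n : ℕ} {f g : (Fin n → ℝ) → (Fin n → ℝ)}
    (hrec : IsRecessionFunction f g) (mono : Monotone f) (hom : AddHomogeneous f)
    (hconv : CoordConvex g)
    (hcrit : ∀ C D, IsCriticalClass g C → IsCriticalClass g D → C = D)
    {z : Fin n → ℝ} (hz : g z = z) (i j : Fin n) : z i = z j := by
  have : NeZero n := ⟨by rintro rfl; exact i.elim0⟩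
  have hmono := hrec.monotone mono
  have hhom := hrec.addHomogeneous hom
  have heig : IsAddEigenvector g 0 := ⟨0, by rw [hrec.map_zero]; simp; rfl⟩
  have hsuper : ∀ P ∈ vecSubdifferential g 0, P.mulVec z ≤ z := by
    intro P hP
    simpa [hrec.map_zero, hz] using hP z
  have harc : ∀ a b, (criticalDigraphAt g 0).Arc a b → z a = z b := by
    rintro a b ⟨P, hP, F, hF, ha, hb, -⟩
    exact eq_of_mem_isFinalClass (nonneg_of_mem_vecSubdifferential hP hmono)
      (sum_row_of_mem_vecSubdifferential hP hhom) (hsuper P hP) hF ha hb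
  have hnodes : ∀ a ∈ (criticalDigraphAt g 0).nodes, ∀ b ∈ (criticalDigraphAt g 0).nodes,
      z a = z b := by
    intro a ha b hb
    have heq := hcrit _ _ ⟨0, heig, a, ha, rfl⟩ ⟨0, heig, b, hb, rfl⟩
    have hba : b ∈ {c | c ∈ (criticalDigraphAt g 0).nodes ∧
        (criticalDigraphAt g 0).HasAccess a c ∧ (criticalDigraphAt g 0).HasAccess c a} := by
      rw [heq]
      exact ⟨hb, .refl, .refl⟩
    exact (hba.2.1.mem_of_closed (S := {c | z a = z c})
      (fun c hc d hcd => (Set.mem_ofPred.1 hc).trans (harc c d hcd)) rfl)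
  obtain ⟨P, hP, hPz⟩ := hrec.exists_mem_vecSubdifferential hconv z
  rw [hz] at hPz
  have hP0 := nonneg_of_mem_vecSubdifferential hP hmono
  have hP1 := sum_row_of_mem_vecSubdifferential hP hhom
  obtain ⟨a, ha, hamin⟩ := exists_mem_finalDigraph_forall_le hP0 hP1 hPz.le
  -- The equality `P z = z`, not just `P z ≤ z`, makes `-z` superharmonic too and so locates the
  -- maximum of `z`.
  obtain ⟨b, hb, hbmin⟩ := exists_mem_finalDigraph_forall_le (z := -z) hP0 hP1
    (by rw [Matrix.mulVec_neg, hPz])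
  have hab := hnodes a ⟨P, hP, ha⟩ b ⟨P, hP, hb⟩
  have hi := hbmin i
  have hj := hbmin j
  simp only [Pi.neg_apply] at hi hj
  linarith [hamin i, hamin j]

/-- A monotone homogeneous map has an eigenvector if its recession function exists, is convex,
and has only one critical class. -/
theorem corollary1p2 (n : ℕ) (f fhat : (Fin n → ℝ) → (Fin n → ℝ))
    (hf_mono : Monotone f) (hf_hom : AddHomogeneous f)
    (h_rec : IsRecessionFunction f fhat) (h_conv : CoordConvex fhat)
    (h_crit : ∃! C : Set (Fin n), IsCriticalClass fhat C) :
    ∃ v : Fin n → ℝ, IsAddEigenvector f v :=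
  h_rec.exists_isAddEigenvector hf_mono hf_hom fun _ hz =>
    h_rec.eq_of_fixedPoint hf_mono hf_hom h_conv (fun _ _ hC hD => h_crit.unique hC hD) hz
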